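/- **Setting.** In a stochastic set cover instance there are a universe $U$ of $n$ elements and $m$ independent random subsets of $U$ with known laws (the items, each of unit cost), such that the union of all items equals $U$ under every realization. Let $f(S)$ be the number of elements covered by the realized sets of the chosen items $S$, and $Q=f$ of everything, so $Q=n$. An adaptive algorithm repeatedly chooses the next item as a function of the realizations seen so far, until $U$ is covered. For $r\ge 1$, an $r$-round adaptive algorithm chooses in each of $r$ rounds, as functions of the realizations seen in previous rounds, an ordering of the remaining items and a threshold $\tau\in\mathbb N$, and inserts items in this order until $f(S)\ge\tau$ (tested after each insertion, and inserting nothing once $U$ is covered); after $r$ rounds $U$ must be covered under every realization. Algorithms have unbounded computational power, and an $r$-round algorithm may be randomized. The cost is the number of chosen items. $\mathrm{OPT}$ denotes the minimum expected cost of an adaptive algorithm. For integers $1\le k\le s\le b\le d$, an $(s,b,k,d)$-edifice over $U$ is the complete $d$-ary rooted tree with $k$ levels (the root at level $1$, the leaves at level $k$) together with sets $U_v\subseteq U$ for its vertices $v$ such that $U_{\mathrm{root}}=U$; $U_u\subseteq U_v$ if $u$ is a child of $v$; $|U_v|=b$ for every leaf $v$; and $|U_u\cap U_v|\le s$ for every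 leaf $u$ and every vertex $v$ that is not an ancestor of $u$ (a vertex counts as an ancestor of itself). Its instance has one item for each vertex and one for each element: the item of a non-leaf $u$ is $U_u\setminus U_v$ for a uniformly random child $v$ of $u$; the item of a leaf $u$ is $U_u\setminus\{e\}$ for a uniformly random $e\in U_u$; the item of an element $e\in U$ is always $\{e\}$. **Theorem.** 1. There are infinitely many integers $N$ such that for every $r\ge 1$ with $4r\le N$ there is a $(4r,N,r,N^2)$-edifice over a universe of size $N^r$. 2. There are absolute constants $c>0$ and $C,K\in\mathbb N$ such that for all integers $r\ge 1$ and $N\ge K r^2$, every universe $U$ of size $n=N^r$ and every $(4r,N,r,N^2)$-edifice over $U$, the instance of the edifice satisfies: * it has $m\le n^{Cr}$ items; * every $r$-round adaptive algorithm, deterministic or randomized, has expected cost at least $c\,\dfrac{n^{1/r}}{r^3}\cdot\mathrm{OPT}$; * some deterministic $(r+1)$-round adaptive algorithm has cost at most $r+1$ on every realization and expected cost exactly $\mathrm{OPT}$. -/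

import Mathlib

open scoped ENNReal

/-! ### Stochastic set cover -/

/-- A (unit cost) stochastic set cover instance: a family of independent random subsets of the
universe `U`, one for each item `i : ι`, given by their laws. Every realization of the whole family
covers the universe. -/
structure StochasticSetCover (ι U : Type) where
  law : ι → PMF (Finset U)
  feasible : ∀ x : ι → Finset U, (∀ i, x i ∈ (law i).support) → ∀ e : U, ∃ i, e ∈ x i

namespace StochasticSetCover

variable {ι U : Type}

/-- `x` is a possible joint realization of the stochastic sets of the instance. -/
def IsRealization (I : StochasticSetCover ι U) (x : ι → Finset U) : Prop :=
  ∀ i, x i ∈ (I.law i).support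

/-- Expectation of `g` under the product of the laws, i.e. over independent stochastic sets. -/
noncomputable def expect [Fintype ι] [DecidableEq ι] [Fintype U] (I : StochasticSetCover ι U)
    (g : (ι → Finset U) → ℝ≥0∞) : ℝ≥0∞ :=
  ∑ x : ι → Finset U, (∏ i, I.law i (x i)) * g x

end StochasticSetCover

/-- What an algorithm has seen: the realizations of the chosen items, `none` for the others. -/
abbrev PartialRealization (ι U : Type) := ι → Option (Finset U)

/-- What an algorithm sees under the realization `x` after it has chosen the items in `S`. -/
def observe {ι U : Type} [DecidableEq ι] (x : ι → Finset U) (S : Finset ι) :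
    PartialRealization ι U :=
  fun i => if i ∈ S then some (x i) else none

/-- The elements covered by the items in `S` under the realization `x`. -/
def covered {ι U : Type} [DecidableEq U] (x : ι → Finset U) (S : Finset ι) : Finset U :=
  S.biUnion x

/-! ### Algorithms with `r` rounds of adaptivity -/

/-- One round with threshold `τ`: starting from the chosen items `S`, insert the items of the list
one by one until at least `τ` elements are covered (the test is made after each insertion, so that
threshold `0` means to insert one item). Nothing is inserted once the universe is covered. -/
def runRound {ι U : Type} [DecidableEq ι] [Fintype U] [DecidableEq U] (x : ι → Finset U) (τ : ℕ) :
    List ι → Finset ι → Finset ι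
  | [], S => S
  | i :: l, S =>
    if covered x S = Finset.univ then S
    else if τ ≤ (covered x (insert i S)).card then insert i S
    else runRound x τ l (insert i S)

/-- The decisions of a round-based algorithm: in round `t` (counted from `0`) it chooses an ordering
of the remaining items and a threshold, as functions of what it has seen in the previous rounds. -/
structure RoundStrategy (ι U : Type) where
  order : ℕ → PartialRealization ι U → List ι
  threshold : ℕ → PartialRealization ι U → ℕ
  nodup_order : ∀ t ψ, (order t ψ).Nodup
  mem_order_iff : ∀ t ψ i, i ∈ order t ψ ↔ ψ i = none

/-- The items chosen in the first `t` rounds under the realization `x`. -/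
def RoundStrategy.chosen {ι U : Type} [DecidableEq ι] [Fintype U] [DecidableEq U]
    (A : RoundStrategy ι U) (x : ι → Finset U) : ℕ → Finset ι
  | 0 => ∅
  | t + 1 =>
    runRound x (A.threshold t (observe x (A.chosen x t))) (A.order t (observe x (A.chosen x t)))
      (A.chosen x t)

/-- A deterministic `r`-round adaptive algorithm for the instance `I`: after `r` rounds the universe
is covered, whatever the realization. -/
structure RoundAlgorithm {ι U : Type} [DecidableEq ι] [Fintype U] [DecidableEq U]
    (I : StochasticSetCover ι U) (r : ℕ) extends RoundStrategy ι U where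
  covers : ∀ x, I.IsRealization x → covered x (toRoundStrategy.chosen x r) = Finset.univ

namespace RoundAlgorithm

variable {ι U : Type} [DecidableEq ι] [Fintype U] [DecidableEq U]
  {I : StochasticSetCover ι U} {r : ℕ}

/-- The number of stochastic sets chosen under the realization `x`. -/
def cost (A : RoundAlgorithm I r) (x : ι → Finset U) : ℕ :=
  (A.toRoundStrategy.chosen x r).card

noncomputable def expectedCost [Fintype ι] (A : RoundAlgorithm I r) : ℝ≥0∞ :=
  I.expect fun x => (A.cost x : ℝ≥0∞)

end RoundAlgorithm

/-- A randomized `r`-round adaptive algorithm: a random choice of a deterministic one, independent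
of the stochastic sets. -/
abbrev RandomizedRoundAlgorithm {ι U : Type} [DecidableEq ι] [Fintype U] [DecidableEq U]
    (I : StochasticSetCover ι U) (r : ℕ) :=
  PMF (RoundAlgorithm I r)

noncomputable def RandomizedRoundAlgorithm.expectedCost {ι U : Type} [Fintype ι] [DecidableEq ι]
    [Fintype U] [DecidableEq U] {I : StochasticSetCover ι U} {r : ℕ}
    (A : RandomizedRoundAlgorithm I r) : ℝ≥0∞ :=
  ∑' D : RoundAlgorithm I r, A D * D.expectedCost

/-! ### Fully adaptive algorithms and the optimum -/

/-- The items chosen in the first `t` steps, under the realization `x`, when the next item is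
always chosen by `next` as a function of what has been seen. Nothing is inserted once the universe
is covered. -/
def adaptiveChosen {ι U : Type} [DecidableEq ι] [Fintype U] [DecidableEq U]
    (next : PartialRealization ι U → ι) (x : ι → Finset U) : ℕ → Finset ι
  | 0 => ∅
  | t + 1 =>
    if covered x (adaptiveChosen next x t) = Finset.univ then adaptiveChosen next x t
    else insert (next (observe x (adaptiveChosen next x t))) (adaptiveChosen next x t)

/-- A fully adaptive algorithm for `I`. There are as many steps as items; choosing an item
again leaves the state unchanged forever, so that `covers` excludes it. -/
structure AdaptiveAlgorithm {ι U : Type} [Fintype ι] [DecidableEq ι] [Fintype U] [DecidableEq U]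
    (I : StochasticSetCover ι U) where
  next : PartialRealization ι U → ι
  covers : ∀ x, I.IsRealization x →
    covered x (adaptiveChosen next x (Fintype.card ι)) = Finset.univ

noncomputable def AdaptiveAlgorithm.expectedCost {ι U : Type} [Fintype ι] [DecidableEq ι]
    [Fintype U] [DecidableEq U] {I : StochasticSetCover ι U} (A : AdaptiveAlgorithm I) : ℝ≥0∞ :=
  I.expect fun x => ((adaptiveChosen A.next x (Fintype.card ι)).card : ℝ≥0∞)

/-- The expected cost of the optimal adaptive algorithm. -/
noncomputable def StochasticSetCover.optCost {ι U : Type} [Fintype ι] [DecidableEq ι]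
    [Fintype U] [DecidableEq U] (I : StochasticSetCover ι U) : ℝ≥0∞ :=
  ⨅ A : AdaptiveAlgorithm I, A.expectedCost

/-! ### Edifices -/

/-- The vertices of the complete `d`-ary rooted tree with `k` levels, as paths from the root: the
root (level `1`) is the empty list, and the children of `u` are the lists `u ++ [j]`. -/
abbrev TreeNode (d k : ℕ) := {l : List (Fin d) // l.length < k}

noncomputable instance (d k : ℕ) : Fintype (TreeNode d k) :=
  (List.finite_length_lt (Fin d) k).fintype

namespace TreeNode

variable {d k : ℕ}

/-- The vertices at level `k`. -/
def IsLeaf (u : TreeNode d k) : Prop := u.1.length + 1 = k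

/-- The `j`-th child of a vertex that is not a leaf. -/
def child (u : TreeNode d k) (h : u.1.length + 1 < k) (j : Fin d) : TreeNode d k :=
  ⟨u.1 ++ [j], by simpa using h⟩

/-- `v` is an ancestor of `u`; every vertex is an ancestor of itself. -/
def IsAncestor (v u : TreeNode d k) : Prop := v.1 <+: u.1

end TreeNode

/-- An `(s, b, k, d)`-edifice over the universe `U`. -/
structure Edifice (s b k d : ℕ) (U : Type) [Fintype U] [DecidableEq U] where
  one_le_k : 1 ≤ k
  k_le_s : k ≤ s
  s_le_b : s ≤ b
  b_le_d : b ≤ d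
  setAt : TreeNode d k → Finset U
  setAt_root : setAt ⟨[], one_le_k⟩ = Finset.univ
  setAt_child_subset : ∀ (u : TreeNode d k) (h : u.1.length + 1 < k) (j : Fin d),
    setAt (u.child h j) ⊆ setAt u
  card_setAt_leaf : ∀ u : TreeNode d k, u.IsLeaf → (setAt u).card = b
  card_inter_le : ∀ u v : TreeNode d k, u.IsLeaf → ¬ v.IsAncestor u →
    (setAt u ∩ setAt v).card ≤ s

namespace Edifice

variable {s b k d : ℕ} {U : Type} [Fintype U] [DecidableEq U]

theorem nonempty_children (T : Edifice s b k d U) : Nonempty (Fin d) :=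
  ⟨⟨0, by have := T.one_le_k; have := T.k_le_s; have := T.s_le_b; have := T.b_le_d; omega⟩⟩

theorem setAt_leaf_nonempty (T : Edifice s b k d U) (u : TreeNode d k)
    (h : ¬ u.1.length + 1 < k) : (T.setAt u).Nonempty := by
  rw [← Finset.card_pos, T.card_setAt_leaf u (by have := u.2; unfold TreeNode.IsLeaf; omega)]
  have := T.one_le_k; have := T.k_le_s; have := T.s_le_b; omega

/-- The laws of the hard instance. The stochastic set of a vertex `u` that is not a leaf is
`U_u \ U_v` for a uniformly random child `v` of `u`; that of a leaf `u` is `U_u \ {e}` for a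
uniformly random `e ∈ U_u`; that of an element `e` is always `{e}`. -/
noncomputable def hardLaw (T : Edifice s b k d U) : TreeNode d k ⊕ U → PMF (Finset U)
  | Sum.inl u =>
    if h : u.1.length + 1 < k then
      haveI := T.nonempty_children
      (PMF.uniformOfFintype (Fin d)).map fun j => T.setAt u \ T.setAt (u.child h j)
    else
      (PMF.uniformOfFinset (T.setAt u) (T.setAt_leaf_nonempty u h)).map fun e => T.setAt u \ {e}
  | Sum.inr e => PMF.pure {e}

/-- The hard stochastic set cover instance of an edifice: one stochastic set for each vertex and one
for each element. -/
noncomputable def hardInstance (T : Edifice s b k d U) :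
    StochasticSetCover (TreeNode d k ⊕ U) U where
  law := T.hardLaw
  feasible := by
    intro x hx e
    refine ⟨Sum.inr e, ?_⟩
    have h := hx (Sum.inr e)
    simp only [hardLaw, PMF.support_pure, Set.mem_singleton_iff] at h
    simp [h]

end Edifice

/-! For a prime `N = p`, the universe is the affine space of dimension `r` over the field with `p`
elements. Each tree edge is a line predicting one more coordinate from the first. A leaf set is a
graph over the first coordinate, so it has `p` points, and two distinct lines share at most one
point.

In an instance with `k` levels, the item of a vertex `u` of the random path leaves uncovered exactly
the set of the next vertex, and the leaf item leaves one element. Following the path thus costs `k +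
1`. No cover is smaller (`card_cover`): if at most `k` items are chosen, small intersections force
all `k` path vertices among them, and none of these covers the missing element. So the optimum is `k
+ 1`.

With only `k` rounds, the ordering used in round `t` is fixed before the path vertex of depth `t`
reveals its child, unless that vertex was reached earlier. An algorithm of cost at most `M` inserts
only items among the first `M` of each ordering, and these meet the subtrees of at most `M` of the
`d` children. If the path is never overtaken in this way, the leaf item is unseen when the last
round starts. The missing element is then uniform in a set of size `b`, and must lie in one of at
most `2M` sets that each meet it in at most `s` points. A cheap run therefore needs luck somewhere
(`exists_lucky`), and a union bound along the path (`le_expectedCost`) gives failure for `M` of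
order `N / r`. -/

/-! ### Edifices from lines over a prime field -/

/-- The lines `y = a x + b` over `ZMod p`, coded by numbers below `p ^ 2`. -/
noncomputable def lineEquiv (p : ℕ) [Fact p.Prime] : Fin (p ^ 2) ≃ ZMod p × ZMod p :=
  Fintype.equivOfCardEq (by simp [ZMod.card, sq])

noncomputable def affineEquiv (p r : ℕ) [Fact p.Prime] : Fin (p ^ r) ≃ (Fin r → ZMod p) :=
  Fintype.equivOfCardEq (by simp [ZMod.card])

theorem line_eq_of_two_points {F : Type} [Field F] {l m : F × F} {s t : F} (h : s ≠ t)
    (hs : l.1 * s + l.2 = m.1 * s + m.2) (ht : l.1 * t + l.2 = m.1 * t + m.2) : l = m := by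
  have h1 : (l.1 - m.1) * (s - t) = 0 := by linear_combination hs - ht
  have h2 : l.1 = m.1 := by
    rcases mul_eq_zero.1 h1 with h | h'
    · exact sub_eq_zero.1 h
    · exact absurd (sub_eq_zero.1 h') h
  refine Prod.ext h2 ?_
  rw [h2] at hs
  exact add_left_cancel hs

open Classical in
/-- The edifice of points of an affine space over a prime field: a path in the tree is a sequence
of lines, and a point lies in the set of the path if each line predicts one further
coordinate from the first one. -/
noncomputable def affineEdifice (p r : ℕ) [Fact p.Prime] (hr : 1 ≤ r) (hp : 4 * r ≤ p) :
    Edifice (4 * r) p r (p ^ 2) (Fin (p ^ r)) where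
  one_le_k := hr
  k_le_s := by omega
  s_le_b := hp
  b_le_d := Nat.le_self_pow two_ne_zero p
  setAt u := Finset.univ.filter fun x => ∀ (i : ℕ) (h : i < u.1.length),
    affineEquiv p r x ⟨i + 1, by have := u.2; omega⟩ =
      (lineEquiv p u.1[i]).1 * affineEquiv p r x ⟨0, hr⟩ + (lineEquiv p u.1[i]).2
  setAt_root := by simp
  setAt_child_subset u h j x hx := by
    simp only [Finset.mem_filter, Finset.mem_univ, true_and] at hx ⊢
    intro i hi
    have := hx i (by simp [TreeNode.child]; omega)
    simpa [TreeNode.child, List.getElem_append_left hi] using this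
  card_setAt_leaf u hu := by
    have hu' : u.1.length + 1 = r := hu
    refine Eq.trans ?_ (Finset.card_univ.trans (ZMod.card p))
    -- At a leaf every coordinate but the first is predicted, so the first one parametrizes the set.
    refine Finset.card_bij (fun x _ => affineEquiv p r x ⟨0, hr⟩) (by simp) ?_ ?_
    · intro x hx y hy hxy
      simp only [Finset.mem_filter, Finset.mem_univ, true_and] at hx hy
      apply (affineEquiv p r).injective
      funext ⟨i, hi⟩
      rcases i with _ | i
      · exact hxy
      · rw [hx i (by omega), hy i (by omega), hxy]
    · intro t _
      refine ⟨(affineEquiv p r).symm fun i => if h : i.1 = 0 then t else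
        (lineEquiv p (u.1[i.1 - 1]'(by have := i.2; omega))).1 * t +
          (lineEquiv p (u.1[i.1 - 1]'(by have := i.2; omega))).2, ?_, by simp⟩
      simp
  card_inter_le u v hu hv := by
    have hu' : u.1.length + 1 = r := hu
    have hv2 := v.2
    -- As `v` is no longer than the leaf `u`, not being a prefix means disagreeing at some index.
    have hex : ∃ (i : ℕ) (h : i < v.1.length), v.1[i] ≠ u.1[i]'(by omega) := by
      by_contra hcon
      push Not at hcon
      refine hv ?_
      rw [TreeNode.IsAncestor, List.prefix_iff_getElem]
      exact ⟨by omega, fun i hi => hcon i hi⟩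
    obtain ⟨i, hi, hne⟩ := hex
    -- Two common points would have different first coordinates, because `u` predicts all the
    -- others; the lines of `u` and `v` at index `i` would then agree at two abscissas.
    refine le_trans (Finset.card_le_one.2 ?_) (by omega : 1 ≤ 4 * r)
    intro x hx y hy
    simp only [Finset.mem_inter, Finset.mem_filter, Finset.mem_univ, true_and] at hx hy
    by_contra hxy
    have h0 : affineEquiv p r x ⟨0, hr⟩ ≠ affineEquiv p r y ⟨0, hr⟩ := by
      intro h0
      refine hxy ((affineEquiv p r).injective ?_)
      funext ⟨i, hi⟩
      rcases i with _ | i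
      · exact h0
      · rw [hx.1 i (by omega), hy.1 i (by omega), h0]
    refine hne ((lineEquiv p).injective (line_eq_of_two_points h0 ?_ ?_))
    · rw [← hx.1 i, ← hx.2 i hi]
    · rw [← hy.1 i, ← hy.2 i hi]

theorem infinite_setOf_edifice : {N : ℕ | ∀ r : ℕ, 1 ≤ r → 4 * r ≤ N →
    Nonempty (Edifice (4 * r) N r (N ^ 2) (Fin (N ^ r)))}.Infinite :=
  Nat.infinite_setOfPred_prime.mono fun p hp r hr hpr =>
    haveI : Fact p.Prime := ⟨hp⟩
    ⟨affineEdifice p r hr hpr⟩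

/-! ### Expectations under product laws -/

theorem PMF.sum_map_mul {α β : Type} [Fintype α] [Fintype β] (p : PMF α) (f : α → β)
    (g : β → ℝ≥0∞) : ∑ b, p.map f b * g b = ∑ a, p a * g (f a) := by
  classical
  simp only [PMF.map_apply, tsum_fintype, Finset.sum_mul]
  rw [Finset.sum_comm]
  refine Finset.sum_congr rfl fun a _ => ?_
  rw [Finset.sum_eq_single (f a)] <;> simp +contextual

theorem PMF.sum_coe {α : Type} [Fintype α] (p : PMF α) : ∑ a, p a = 1 := by
  rw [← tsum_fintype (L := .unconditional _), p.tsum_coe]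

namespace StochasticSetCover

variable {ι U : Type} [Fintype ι] [DecidableEq ι] [Fintype U] (I : StochasticSetCover ι U)

theorem expect_mono {g h : (ι → Finset U) → ℝ≥0∞} (H : ∀ x, I.IsRealization x → g x ≤ h x) :
    I.expect g ≤ I.expect h := by
  refine Finset.sum_le_sum fun x _ => ?_
  by_cases hx : I.IsRealization x
  · exact mul_le_mul_right (H x hx) _
  · simp only [IsRealization, not_forall] at hx
    obtain ⟨i, hi⟩ := hx
    rw [PMF.mem_support_iff, not_not] at hi
    rw [Finset.prod_eq_zero (Finset.mem_univ i) hi]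
    simp

theorem expect_const (c : ℝ≥0∞) : (I.expect fun _ => c) = c := by
  have h : ∑ x : ι → Finset U, ∏ i, I.law i (x i) = 1 := by
    rw [← Fintype.piFinset_univ, ← Finset.prod_univ_sum]
    exact Finset.prod_eq_one fun i _ => (I.law i).sum_coe
  rw [expect, ← Finset.sum_mul, h, one_mul]

theorem expect_add (g h : (ι → Finset U) → ℝ≥0∞) :
    (I.expect fun x => g x + h x) = I.expect g + I.expect h := by
  simp only [expect, mul_add, Finset.sum_add_distrib]

theorem expect_const_mul (c : ℝ≥0∞) (g : (ι → Finset U) → ℝ≥0∞) :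
    (I.expect fun x => c * g x) = c * I.expect g := by
  simp only [expect, Finset.mul_sum]
  exact Finset.sum_congr rfl fun x _ => mul_left_comm _ _ _

theorem expect_sum {κ : Type} (s : Finset κ) (g : κ → (ι → Finset U) → ℝ≥0∞) :
    (I.expect fun x => ∑ k ∈ s, g k x) = ∑ k ∈ s, I.expect (g k) := by
  simp only [expect, Finset.mul_sum]
  exact Finset.sum_comm

/-- Drawing the set of one item afresh does not change expectations. -/
theorem expect_resample (i : ι) (g : (ι → Finset U) → ℝ≥0∞) :
    (I.expect fun x => ∑ Y, I.law i Y * g (Function.update x i Y)) = I.expect g := by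
  have key : ∀ (x : ι → Finset U) (Y : Finset U),
      (∏ j, I.law j (x j)) * I.law i Y =
        (∏ j, I.law j (Function.update x i Y j)) * I.law i (x i) := by
    intro x Y
    rw [← Finset.mul_prod_erase _ _ (Finset.mem_univ i),
      ← Finset.mul_prod_erase (a := i) _ (fun j => I.law j (Function.update x i Y j))
        (Finset.mem_univ i)]
    have : ∏ j ∈ Finset.univ.erase i, I.law j (Function.update x i Y j) =
        ∏ j ∈ Finset.univ.erase i, I.law j (x j) :=
      Finset.prod_congr rfl fun j hj => by
        rw [Function.update_of_ne (Finset.ne_of_mem_erase hj)]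
    rw [this, Function.update_self]
    ring
  have h1 : (I.expect fun x => ∑ Y, I.law i Y * g (Function.update x i Y)) =
      ∑ z : (ι → Finset U) × Finset U,
        (∏ j, I.law j (z.1 j)) * I.law i z.2 * g (Function.update z.1 i z.2) := by
    rw [expect, Fintype.sum_prod_type]
    refine Finset.sum_congr rfl fun x _ => ?_
    rw [Finset.mul_sum]
    exact Finset.sum_congr rfl fun Y _ => (mul_assoc _ _ _).symm
  have h2 : I.expect g = ∑ z : (ι → Finset U) × Finset U,
        (∏ j, I.law j (z.1 j)) * I.law i z.2 * g z.1 := by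
    rw [expect, Fintype.sum_prod_type]
    refine Finset.sum_congr rfl fun x _ => ?_
    simp only
    rw [← Finset.sum_mul, ← Finset.mul_sum, (I.law i).sum_coe, mul_one]
  rw [h1, h2]
  -- Exchanging `x i` with the fresh draw is an involution that preserves the joint weight.
  refine Finset.sum_nbij' (fun z => (Function.update z.1 i z.2, z.1 i))
    (fun z => (Function.update z.1 i z.2, z.1 i)) (by simp) (by simp) (by simp) (by simp) ?_
  intro z _
  exact congrArg (· * g _) (key z.1 z.2)

/-- If an event forces a property `F` of the other items, and the set of `i` into a family of
probability at most `ε` that depends only on the other items, then its probability is at most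
`ε` times that of `F`. -/
theorem expect_indicator_le (i : ι) (E F : (ι → Finset U) → Prop) [DecidablePred E]
    [DecidablePred F] (ε : ℝ≥0∞)
    (hF : ∀ x Y, E (Function.update x i Y) → F x)
    (hE : ∀ x, ∑ Y, I.law i Y * (if E (Function.update x i Y) then 1 else 0) ≤ ε) :
    (I.expect fun x => if E x then 1 else 0) ≤ ε * I.expect fun x => if F x then 1 else 0 := by
  rw [← I.expect_resample i, ← expect_const_mul]
  refine I.expect_mono fun x _ => ?_
  by_cases h : F x
  · simpa [h] using hE x
  · have : ∀ Y, ¬ E (Function.update x i Y) := fun Y hY => h (hF x Y hY)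
    simp [this]

end StochasticSetCover

/-! ### Runs of round-based algorithms -/

section Rounds

variable {ι U : Type}

theorem covered_congr [DecidableEq U] {x y : ι → Finset U} {S : Finset ι} (h : ∀ i ∈ S, x i = y i) :
    covered x S = covered y S :=
  Finset.biUnion_congr rfl h

variable [DecidableEq ι]

theorem observe_congr {x y : ι → Finset U} {S : Finset ι} (h : ∀ i ∈ S, x i = y i) :
    observe x S = observe y S := by
  funext i
  by_cases hi : i ∈ S <;> simp [observe, hi, h]

variable [DecidableEq U]

theorem covered_insert (x : ι → Finset U) (i : ι) (S : Finset ι) :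
    covered x (insert i S) = x i ∪ covered x S :=
  Finset.biUnion_insert

variable [Fintype U]

theorem subset_runRound (x : ι → Finset U) (τ : ℕ) (l : List ι) (S : Finset ι) :
    S ⊆ runRound x τ l S := by
  induction l generalizing S with
  | nil => simp [runRound]
  | cons i l ih =>
    rw [runRound]
    split_ifs
    · rfl
    · exact Finset.subset_insert _ _
    · exact (Finset.subset_insert _ _).trans (ih _)

/-- A run tests only sets of items that it ends up choosing, so unchosen items cannot influence it.
This is what later allows an unseen item to be resampled. -/
theorem runRound_congr {x y : ι → Finset U} {τ : ℕ} {l : List ι} {S : Finset ι}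
    (h : ∀ i ∈ runRound x τ l S, x i = y i) : runRound y τ l S = runRound x τ l S := by
  induction l generalizing S with
  | nil => simp [runRound]
  | cons i l ih =>
    have hS : covered x S = covered y S :=
      covered_congr fun j hj => h j (subset_runRound _ _ _ _ hj)
    rw [runRound, runRound, ← hS]
    by_cases h1 : covered x S = Finset.univ
    · simp [h1]
    · have hi : covered x (insert i S) = covered y (insert i S) := by
        refine covered_congr fun j hj => h j ?_
        rw [runRound, if_neg h1]
        split_ifs
        · exact hj
        · exact subset_runRound _ _ _ _ hj
      rw [← hi, if_neg h1, if_neg h1]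
      split_ifs with h2
      · rfl
      · refine ih fun j hj => h j ?_
        rwa [runRound, if_neg h1, if_neg h2]

theorem exists_runRound_eq (x : ι → Finset U) (τ : ℕ) (l : List ι) (S : Finset ι) :
    ∃ m ≤ l.length, runRound x τ l S = S ∪ (l.take m).toFinset := by
  induction l generalizing S with
  | nil => exact ⟨0, by simp [runRound]⟩
  | cons i l ih =>
    rw [runRound]
    split_ifs
    · exact ⟨0, by simp⟩
    · exact ⟨1, by simp, by simp⟩
    · obtain ⟨m, hm, h⟩ := ih (insert i S)
      exact ⟨m + 1, by simpa using hm, by simp [h]⟩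

/-- The inserted items form a prefix without repetitions inside the result, so the prefix has length
at most `M`. A cheap run is thus confined to a list known before the round. -/
theorem runRound_subset_take {x : ι → Finset U} {τ : ℕ} {l : List ι} {S : Finset ι}
    (hl : l.Nodup) {M : ℕ} (hM : (runRound x τ l S).card ≤ M) {i : ι}
    (hi : i ∈ runRound x τ l S) : i ∈ S ∨ i ∈ l.take M := by
  obtain ⟨m, hm, h⟩ := exists_runRound_eq x τ l S
  have hcard : (l.take m).toFinset.card = m := by
    rw [List.toFinset_card_of_nodup (hl.sublist (List.take_sublist _ _)), List.length_take,
      min_eq_left hm]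
  have : m ≤ M := by
    rw [← hcard]
    refine le_trans (Finset.card_le_card ?_) hM
    rw [h]
    exact Finset.subset_union_right
  rw [h, Finset.mem_union, List.mem_toFinset] at hi
  exact hi.imp_right fun h => (List.take_prefix_take_left this).subset h

theorem runRound_zero_cons {x : ι → Finset U} {i : ι} {l : List ι} {S : Finset ι}
    (h : covered x S ≠ Finset.univ) : runRound x 0 (i :: l) S = insert i S := by
  simp [runRound, h]

namespace RoundStrategy

variable (A : RoundStrategy ι U)

theorem chosen_subset_succ (x : ι → Finset U) (t : ℕ) : A.chosen x t ⊆ A.chosen x (t + 1) :=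
  subset_runRound _ _ _ _

theorem chosen_mono (x : ι → Finset U) : Monotone (A.chosen x) :=
  monotone_nat_of_le_succ (A.chosen_subset_succ x)

theorem chosen_congr {x y : ι → Finset U} {t : ℕ} (h : ∀ i ∈ A.chosen x t, x i = y i) :
    A.chosen y t = A.chosen x t := by
  induction t with
  | zero => rfl
  | succ t ih =>
    have h' : ∀ i ∈ A.chosen x t, x i = y i := fun i hi => h i (A.chosen_subset_succ x t hi)
    have ht := ih h'
    rw [chosen, ht, ← observe_congr h']
    exact runRound_congr h

theorem chosen_update {x : ι → Finset U} {t : ℕ} {i : ι} (hi : i ∉ A.chosen x t) (Y : Finset U) :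
    A.chosen (Function.update x i Y) t = A.chosen x t :=
  A.chosen_congr fun j hj => by
    rw [Function.update_of_ne]
    rintro rfl
    exact hi hj

theorem observe_update {x : ι → Finset U} {t : ℕ} {i : ι} (hi : i ∉ A.chosen x t)
    (Y : Finset U) :
    observe (Function.update x i Y) (A.chosen (Function.update x i Y) t) =
      observe x (A.chosen x t) := by
  rw [A.chosen_update hi]
  refine observe_congr fun j hj => Function.update_of_ne ?_ _ _
  rintro rfl
  exact hi hj

theorem mem_chosen_succ {x : ι → Finset U} {t M : ℕ} (hM : (A.chosen x (t + 1)).card ≤ M) {i : ι}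
    (hi : i ∈ A.chosen x (t + 1)) :
    i ∈ A.chosen x t ∨ i ∈ (A.order t (observe x (A.chosen x t))).take M :=
  runRound_subset_take (A.nodup_order _ _) hM hi

end RoundStrategy

/-! ### Round strategies that choose one item per round -/

section Sequential

theorem card_adaptiveChosen_le (next : PartialRealization ι U → ι) (x : ι → Finset U) (t : ℕ) :
    (adaptiveChosen next x t).card ≤ t := by
  induction t with
  | zero => simp [adaptiveChosen]
  | succ t ih =>
    rw [adaptiveChosen]
    split_ifs
    · omega
    · exact (Finset.card_insert_le _ _).trans (by omega)

theorem adaptiveChosen_of_covered {next : PartialRealization ι U → ι} {x : ι → Finset U} {t t' : ℕ}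
    (h : covered x (adaptiveChosen next x t) = Finset.univ) (ht : t ≤ t') :
    adaptiveChosen next x t' = adaptiveChosen next x t := by
  induction t', ht using Nat.le_induction with
  | base => rfl
  | succ t' _ ih => rw [adaptiveChosen, ih, if_pos h]

variable [Fintype ι]

open Classical in
/-- The ordering of the unseen items that starts with `next ψ`, if that item is unseen. -/
noncomputable def nextFirst (next : PartialRealization ι U → ι) (ψ : PartialRealization ι U) :
    List ι :=
  if ψ (next ψ) = none then
    next ψ :: ((Finset.univ.filter fun i => ψ i = none).erase (next ψ)).toList
  else (Finset.univ.filter fun i => ψ i = none).toList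

/-- The round strategy that chooses `next ψ` alone in each round, where `ψ` is what it has seen. -/
noncomputable def sequentialStrategy (next : PartialRealization ι U → ι) : RoundStrategy ι U where
  order _ ψ := nextFirst next ψ
  threshold _ _ := 0
  nodup_order t ψ := by
    unfold nextFirst
    split_ifs
    · exact List.nodup_cons.2 ⟨by simp, Finset.nodup_toList _⟩
    · exact Finset.nodup_toList _
  mem_order_iff t ψ i := by
    unfold nextFirst
    split_ifs with h
    · by_cases hi : i = next ψ
      · simp [hi, h]
      · simp [hi]
    · simp

/-- Each step adds at most one item, so `t` items after `t` steps means that every step inserted a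
new one: neither a repetition nor an early cover occurred. -/
theorem sequentialStrategy_chosen {next : PartialRealization ι U → ι} {x : ι → Finset U} {t : ℕ}
    (h : t ≤ (adaptiveChosen next x t).card) :
    (sequentialStrategy next).chosen x t = adaptiveChosen next x t := by
  induction t with
  | zero => rfl
  | succ t ih =>
    have hle := card_adaptiveChosen_le next x t
    rw [adaptiveChosen] at h
    have hc : covered x (adaptiveChosen next x t) ≠ Finset.univ := by
      intro hc
      rw [if_pos hc] at h
      omega
    rw [if_neg hc] at h
    have hmem : next (observe x (adaptiveChosen next x t)) ∉ adaptiveChosen next x t := by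
      intro hmem
      rw [Finset.insert_eq_of_mem hmem] at h
      omega
    rw [Finset.card_insert_of_notMem hmem] at h
    rw [RoundStrategy.chosen, ih (by omega), adaptiveChosen, if_neg hc]
    simp only [sequentialStrategy, nextFirst]
    rw [if_pos (by simp [observe, hmem]), runRound_zero_cons hc]

end Sequential

end Rounds

/-! ### Combinatorics of the tree -/

namespace TreeNode

variable {d k : ℕ} {u v w : TreeNode d k}

theorem IsAncestor.refl (u : TreeNode d k) : u.IsAncestor u :=
  List.prefix_rfl

theorem IsAncestor.trans (h : u.IsAncestor v) (h' : v.IsAncestor w) : u.IsAncestor w :=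
  List.IsPrefix.trans h h'

theorem IsAncestor.length_le (h : u.IsAncestor v) : u.1.length ≤ v.1.length :=
  List.IsPrefix.length_le h

theorem IsAncestor.of_length_le (hu : u.IsAncestor w) (hv : v.IsAncestor w)
    (h : u.1.length ≤ v.1.length) : u.IsAncestor v :=
  List.prefix_of_prefix_length_le hu hv h

theorem IsAncestor.eq_of_length_le (h : u.IsAncestor v) (hl : v.1.length ≤ u.1.length) : u = v :=
  Subtype.ext (List.IsPrefix.eq_of_length_le h hl)

theorem IsAncestor.antisymm (h : u.IsAncestor v) (h' : v.IsAncestor u) : u = v :=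
  h.eq_of_length_le h'.length_le

theorem isAncestor_child (u : TreeNode d k) (h : u.1.length + 1 < k) (j : Fin d) :
    u.IsAncestor (u.child h j) :=
  List.prefix_append _ _

theorem length_child (u : TreeNode d k) (h : u.1.length + 1 < k) (j : Fin d) :
    (u.child h j).1.length = u.1.length + 1 := by
  simp [child]

theorem child_isAncestor_inj {h : u.1.length + 1 < k} {i j : Fin d}
    (hi : (u.child h i).IsAncestor v) (hj : (u.child h j).IsAncestor v) : i = j := by
  have := congrArg Subtype.val
    ((hi.of_length_le hj (by simp [length_child])).eq_of_length_le (by simp [length_child]))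
  simpa [child] using this

theorem eq_child_or_isAncestor {h : u.1.length + 1 < k} {j : Fin d}
    (hv : v.IsAncestor (u.child h j)) : v = u.child h j ∨ v.IsAncestor u := by
  by_cases hl : v.1.length ≤ u.1.length
  · exact Or.inr (hv.of_length_le (u.isAncestor_child h j) hl)
  · exact Or.inl (hv.eq_of_length_le (by rw [length_child]; omega))

theorem exists_child_isAncestor (hv : u.IsAncestor v) (hl : u.1.length < v.1.length) :
    ∃ (h : u.1.length + 1 < k) (j : Fin d), (u.child h j).IsAncestor v := by
  obtain ⟨t, ht⟩ := hv
  rcases t with _ | ⟨j, t⟩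
  · simp [← ht] at hl
  · exact ⟨by have := v.2; omega, j, t, by simp [child, ht]⟩

theorem exists_isAncestor_length (v : TreeNode d k) {t : ℕ} (ht : t ≤ v.1.length) :
    ∃ u : TreeNode d k, u.IsAncestor v ∧ u.1.length = t :=
  ⟨⟨v.1.take t, by have := v.2; simp; omega⟩, List.take_prefix _ _, by simpa using ht⟩

theorem exists_leaf_isAncestor (j : Fin d) (u : TreeNode d k) :
    ∃ w : TreeNode d k, w.IsLeaf ∧ u.IsAncestor w := by
  have := u.2
  refine ⟨⟨u.1 ++ List.replicate (k - 1 - u.1.length) j, ?_⟩, ?_, List.prefix_append _ _⟩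
  · simp; omega
  · simp only [IsLeaf, List.length_append, List.length_replicate]; omega

theorem card_le (d k : ℕ) : Fintype.card (TreeNode d k) ≤ (d + 1) ^ k := by
  -- A path is coded as a word of length `k` over `d + 1` letters, padded with `none`.
  have hinj : Function.Injective fun (u : TreeNode d k) (i : Fin k) => u.1[i.1]? := by
    intro u v huv
    refine Subtype.ext (List.ext_getElem? fun i => ?_)
    by_cases hi : i < k
    · exact congrFun huv ⟨i, hi⟩
    · have := u.2
      have := v.2
      rw [List.getElem?_eq_none (by omega), List.getElem?_eq_none (by omega)]
  simpa using Fintype.card_le_of_injective _ hinj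

end TreeNode

/-! ### Edifice sets, the random path and covers -/

namespace Edifice

open TreeNode

variable {s b k d : ℕ} {U : Type} [Fintype U] [DecidableEq U] (T : Edifice s b k d U)

theorem setAt_mono {u v : TreeNode d k} (h : u.IsAncestor v) : T.setAt v ⊆ T.setAt u := by
  obtain ⟨l, hl⟩ := h
  induction l using List.reverseRecOn generalizing v with
  | nil =>
    have : u = v := Subtype.ext (by simpa using hl)
    rw [this]
  | append_singleton l j ih =>
    have hv := v.2
    rw [← hl] at hv
    simp only [List.length_append, List.length_singleton] at hv
    have hlen : (u.1 ++ l).length + 1 < k := by simp only [List.length_append]; omega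
    have : v = TreeNode.child ⟨u.1 ++ l, by omega⟩ hlen j :=
      Subtype.ext (by simp [TreeNode.child, ← hl])
    rw [this]
    exact (T.setAt_child_subset _ hlen j).trans (ih rfl)

theorem exists_leaf (T : Edifice s b k d U) (u : TreeNode d k) : ∃ w : TreeNode d k, w.IsLeaf ∧ u.IsAncestor w :=
  exists_leaf_isAncestor T.nonempty_children.some u

theorem le_card_setAt (u : TreeNode d k) : b ≤ (T.setAt u).card := by
  obtain ⟨w, hw, huw⟩ := T.exists_leaf u
  exact (T.card_setAt_leaf w hw).ge.trans (Finset.card_le_card (T.setAt_mono huw))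

theorem one_le_s (T : Edifice s b k d U) : 1 ≤ s :=
  T.one_le_k.trans T.k_le_s

theorem one_le_b (T : Edifice s b k d U) : 1 ≤ b :=
  T.one_le_s.trans T.s_le_b

theorem setAt_nonempty (u : TreeNode d k) : (T.setAt u).Nonempty :=
  Finset.card_pos.1 (T.one_le_b.trans (T.le_card_setAt u))

theorem setAt_ne_of_leaf (hs : s < b) {u v w : TreeNode d k} (hw : w.IsLeaf)
    (hu : u.IsAncestor w) (hv : ¬ v.IsAncestor w) : T.setAt u ≠ T.setAt v := by
  intro h
  have h1 := T.card_inter_le w v hw hv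
  rw [← h, Finset.inter_eq_left.2 (T.setAt_mono hu), T.card_setAt_leaf w hw] at h1
  omega

/-- Some leaf lies below one of the two vertices but not below the other; its `b > s` elements all
belong to the first set and at most `s` to the second. -/
theorem setAt_injective (hs : s < b) : Function.Injective T.setAt := by
  have key : ∀ u v : TreeNode d k, ¬ v.IsAncestor u → T.setAt u ≠ T.setAt v := by
    intro u v hvu
    by_cases huv : u.IsAncestor v
    · have hl : u.1.length < v.1.length := by
        by_contra hl
        exact hvu (by rw [huv.eq_of_length_le (by omega)]; exact .refl _)
      obtain ⟨h, j, hj⟩ := exists_child_isAncestor huv hl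
      -- When `v` is below `u`, the leaf is taken under a child of `u` off the way to `v`.
      have : Nontrivial (Fin d) :=
        Fin.nontrivial_iff_two_le.2 (by have := T.b_le_d; have := T.one_le_s; omega)
      obtain ⟨i, hij⟩ := exists_ne j
      obtain ⟨w, hw, hiw⟩ := T.exists_leaf (u.child h i)
      exact T.setAt_ne_of_leaf hs hw ((u.isAncestor_child h i).trans hiw) fun hvw =>
        hij (child_isAncestor_inj hiw (hj.trans hvw))
    · obtain ⟨w, hw, huw⟩ := T.exists_leaf u
      refine T.setAt_ne_of_leaf hs hw huw fun hvw => ?_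
      rcases le_total u.1.length v.1.length with hl | hl
      · exact huv (huw.of_length_le hvw hl)
      · exact hvu (hvw.of_length_le huw hl)
  intro u v h
  by_contra hne
  by_cases hvu : v.IsAncestor u
  · exact key v u (fun huv => hne (huv.antisymm hvu)) h.symm
  · exact key u v hvu h

/-! ### Realizations of the hard instance -/

/-- The largest value of the stochastic set of an item. -/
def base : TreeNode d k ⊕ U → Finset U :=
  Sum.elim T.setAt fun e => {e}

theorem card_inter_base_le {w : TreeNode d k} (hw : w.IsLeaf) {i : TreeNode d k ⊕ U}
    (hi : ∀ v, i = Sum.inl v → ¬ v.IsAncestor w) : (T.setAt w ∩ T.base i).card ≤ s := by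
  rcases i with v | e
  · exact T.card_inter_le w v hw (hi v rfl)
  · exact (Finset.card_le_card Finset.inter_subset_right).trans (by simpa [base] using T.one_le_s)

section Realization

variable {T} {x : TreeNode d k ⊕ U → Finset U}

theorem realization_inner (hx : T.hardInstance.IsRealization x) {u : TreeNode d k} (h : u.1.length + 1 < k) :
    ∃ j, x (Sum.inl u) = T.setAt u \ T.setAt (u.child h j) := by
  have hne := T.nonempty_children
  have := hx (Sum.inl u)
  simp only [hardInstance, hardLaw, dif_pos h, PMF.support_map, Set.mem_image] at this
  obtain ⟨j, -, hj⟩ := this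
  exact ⟨j, hj.symm⟩

theorem realization_leaf (hx : T.hardInstance.IsRealization x) {u : TreeNode d k} (h : ¬ u.1.length + 1 < k) :
    ∃ e ∈ T.setAt u, x (Sum.inl u) = T.setAt u \ {e} := by
  have := hx (Sum.inl u)
  simp only [hardInstance, hardLaw, dif_neg h, PMF.support_map, Set.mem_image] at this
  obtain ⟨e, he, hj⟩ := this
  exact ⟨e, by simpa using he, hj.symm⟩

theorem realization_elem (hx : T.hardInstance.IsRealization x) (e : U) : x (Sum.inr e) = {e} := by
  have := hx (Sum.inr e)
  simpa [hardInstance, hardLaw] using this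

theorem realization_subset_base (hx : T.hardInstance.IsRealization x) (i : TreeNode d k ⊕ U) : x i ⊆ T.base i := by
  rcases i with u | e
  · by_cases h : u.1.length + 1 < k
    · obtain ⟨j, hj⟩ := realization_inner hx h
      rw [hj]
      exact Finset.sdiff_subset
    · obtain ⟨e, -, he⟩ := realization_leaf hx h
      rw [he]
      exact Finset.sdiff_subset
  · rw [realization_elem hx e]
    rfl

end Realization

/-- `u` lies on the random path from the root determined by `x`. -/
def Active (x : TreeNode d k ⊕ U → Finset U) (u : TreeNode d k) : Prop :=
  ∀ (a : TreeNode d k) (h : a.1.length + 1 < k) (j : Fin d), (a.child h j).IsAncestor u →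
    x (Sum.inl a) = T.setAt a \ T.setAt (a.child h j)

section Active

variable {T} {x y : TreeNode d k ⊕ U → Finset U} {u v w : TreeNode d k}

theorem active_root : T.Active x ⟨[], T.one_le_k⟩ := by
  intro a h j hj
  have := hj.length_le
  simp [length_child] at this

theorem Active.of_isAncestor (hv : T.Active x v) (h : u.IsAncestor v) : T.Active x u :=
  fun a ha j hj => hv a ha j (hj.trans h)

theorem Active.child (hu : T.Active x u) {h : u.1.length + 1 < k} {j : Fin d}
    (hj : x (Sum.inl u) = T.setAt u \ T.setAt (u.child h j)) : T.Active x (u.child h j) := by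
  intro a ha i hi
  rcases eq_child_or_isAncestor hi with heq | hanc
  · have hau : a = u := Subtype.ext (List.append_inj_left' (congrArg Subtype.val heq) rfl)
    subst hau
    rw [hj, heq]
  · exact hu a ha i hanc

theorem Active.congr (hu : T.Active x u)
    (h : ∀ a : TreeNode d k, a.1.length < u.1.length → x (Sum.inl a) = y (Sum.inl a)) :
    T.Active y u := by
  intro a ha j hj
  rw [← h a, hu a ha j hj]
  have := hj.length_le
  rw [length_child] at this
  omega

theorem Active.disjoint (hu : T.Active x u) {a : TreeNode d k} (ha : a.IsAncestor u)
    (hl : a.1.length < u.1.length) : Disjoint (x (Sum.inl a)) (T.setAt u) := by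
  obtain ⟨h, j, hj⟩ := exists_child_isAncestor ha hl
  rw [hu a h j hj]
  exact Finset.disjoint_of_subset_right (T.setAt_mono hj) Finset.sdiff_disjoint

theorem child_eq_of_sdiff_eq (hs : s < b) {h : u.1.length + 1 < k} {i j : Fin d}
    (hij : T.setAt u \ T.setAt (u.child h i) = T.setAt u \ T.setAt (u.child h j)) : i = j := by
  have hsub := fun j => T.setAt_child_subset u h j
  have h1 : T.setAt (u.child h i) = T.setAt (u.child h j) := by
    rw [← Finset.sdiff_sdiff_eq_self (hsub i), hij, Finset.sdiff_sdiff_eq_self (hsub j)]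
  have h2 := T.setAt_injective hs h1
  exact child_isAncestor_inj (.refl _) (by rw [h2]; exact .refl _)

theorem Active.eq (hs : s < b) (hu : T.Active x u) (hv : T.Active x v)
    (hl : u.1.length = v.1.length) : u = v := by
  by_contra hne
  have key : ∀ t ≤ u.1.length, ∃ a : TreeNode d k,
      a.IsAncestor u ∧ a.IsAncestor v ∧ a.1.length = t := by
    intro t
    induction t with
    | zero => exact fun _ => ⟨⟨[], T.one_le_k⟩, List.nil_prefix, List.nil_prefix, rfl⟩
    | succ t ih =>
      intro ht
      obtain ⟨a, hau, hav, rfl⟩ := ih (by omega)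
      obtain ⟨h, i, hi⟩ := exists_child_isAncestor hau (by omega)
      obtain ⟨h', j, hj⟩ := exists_child_isAncestor hav (by omega)
      have hij : i = j :=
        child_eq_of_sdiff_eq (T := T) hs ((hu a h i hi).symm.trans (hv a h' j hj))
      subst hij
      exact ⟨a.child h i, hi, hj, length_child _ _ _⟩
  obtain ⟨a, hau, hav, ha⟩ := key _ le_rfl
  exact hne ((hau.eq_of_length_le (by omega)).symm.trans (hav.eq_of_length_le (by omega)))

theorem exists_active (hx : T.hardInstance.IsRealization x) {t : ℕ} (ht : t < k) :
    ∃ u, T.Active x u ∧ u.1.length = t := by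
  induction t with
  | zero => exact ⟨_, active_root, rfl⟩
  | succ t ih =>
    obtain ⟨u, hu, rfl⟩ := ih (by omega)
    obtain ⟨j, hj⟩ := realization_inner hx ht
    exact ⟨u.child ht j, hu.child hj, length_child _ _ _⟩

end Active

/-! ### Covers of the hard instance have at least `k + 1` items -/

section Cover

variable {T} {x : TreeNode d k ⊕ U → Finset U} {S : Finset (TreeNode d k ⊕ U)}

/-- Otherwise each of the at most `k` chosen sets would cover at most `s` of the `b > k * s`
elements of the leaf set. -/
theorem exists_ancestor_mem (hb : k * s < b) (hx : T.hardInstance.IsRealization x)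
    (hS : covered x S = Finset.univ) (hk : S.card ≤ k) {w : TreeNode d k} (hw : w.IsLeaf) :
    ∃ v : TreeNode d k, v.IsAncestor w ∧ Sum.inl v ∈ S ∧
      ¬ Disjoint (x (Sum.inl v)) (T.setAt w) := by
  by_contra hcon
  push Not at hcon
  have h1 : T.setAt w ⊆ S.biUnion fun i => T.setAt w ∩ x i := by
    rw [← Finset.inter_biUnion]
    exact Finset.subset_inter (subset_refl _) (by
      rw [covered] at hS
      rw [hS]
      exact Finset.subset_univ _)
  have h2 : ∀ i ∈ S, (T.setAt w ∩ x i).card ≤ s := by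
    intro i hi
    by_cases hanc : ∃ v, i = Sum.inl v ∧ v.IsAncestor w
    · obtain ⟨v, rfl, hv⟩ := hanc
      have := Finset.disjoint_iff_inter_eq_empty.1 (hcon v hv hi)
      rw [Finset.inter_comm, this]
      simp
    · refine le_trans (Finset.card_le_card (Finset.inter_subset_inter_left
        (realization_subset_base hx i))) (T.card_inter_base_le hw fun v hiv hv => ?_)
      exact hanc ⟨v, hiv, hv⟩
  have h3 := (Finset.card_le_card h1).trans (Finset.card_biUnion_le_card_mul _ _ _ h2)
  rw [T.card_setAt_leaf w hw] at h3
  have := Nat.mul_le_mul_right s hk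
  omega

/-- Items of proper ancestors of `a` miss its set. Without `a`, every leaf below it needs a chosen
vertex strictly between `a` and that leaf, or the leaf itself. This is impossible if `a` is a leaf,
and otherwise takes one item per child, hence `d > k` items. -/
theorem active_mem_cover (hb : k * s < b) (hx : T.hardInstance.IsRealization x)
    (hS : covered x S = Finset.univ) (hk : S.card ≤ k) {a : TreeNode d k} (ha : T.Active x a) :
    Sum.inl a ∈ S := by
  by_contra haS
  have below : ∀ w : TreeNode d k, w.IsLeaf → a.IsAncestor w →
      ∃ v : TreeNode d k, v.IsAncestor w ∧ Sum.inl v ∈ S ∧ a.1.length < v.1.length := by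
    intro w hw haw
    obtain ⟨v, hvw, hvS, hdis⟩ := exists_ancestor_mem hb hx hS hk hw
    refine ⟨v, hvw, hvS, ?_⟩
    by_contra hl
    have hva : v.IsAncestor a := hvw.of_length_le haw (by omega)
    rcases Nat.lt_or_ge v.1.length a.1.length with h | h
    · exact hdis (Finset.disjoint_of_subset_right (T.setAt_mono haw) (ha.disjoint hva h))
    · rw [hva.eq_of_length_le h] at hvS
      exact haS hvS
  by_cases h : a.1.length + 1 < k
  · have hchild : ∀ j : Fin d, ∃ v : TreeNode d k,
        (a.child h j).IsAncestor v ∧ Sum.inl v ∈ S := by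
      intro j
      obtain ⟨w, hw, hjw⟩ := T.exists_leaf (a.child h j)
      obtain ⟨v, hvw, hvS, hl⟩ := below w hw ((a.isAncestor_child h j).trans hjw)
      exact ⟨v, hjw.of_length_le hvw (by rw [length_child]; omega), hvS⟩
    choose f hf hfS using hchild
    have hcard : Fintype.card (Fin d) ≤ S.card := by
      rw [← Finset.card_univ]
      refine Finset.card_le_card_of_injOn (fun j => Sum.inl (f j)) (fun j _ => hfS j) ?_
      intro i _ j _ hij
      have hij' : f i = f j := Sum.inl_injective hij
      exact child_isAncestor_inj (hf i) (hij' ▸ hf j)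
    rw [Fintype.card_fin] at hcard
    have := T.b_le_d
    have := Nat.le_mul_of_pos_right k T.one_le_s
    omega
  · have hleaf : a.IsLeaf := by have := a.2; unfold IsLeaf; omega
    obtain ⟨v, hva, -, hl⟩ := below a hleaf (.refl a)
    have := hva.length_le
    omega

theorem card_cover (hb : k * s < b) (hx : T.hardInstance.IsRealization x)
    (hS : covered x S = Finset.univ) : k + 1 ≤ S.card := by
  by_contra hk
  have hk : S.card ≤ k := by omega
  have hk1 := T.one_le_k
  obtain ⟨w, hw, hlen⟩ := exists_active hx (t := k - 1) (by omega)
  obtain ⟨e, he, hxw⟩ := realization_leaf hx (u := w) (by omega)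
  obtain ⟨i, hiS, hi⟩ := Finset.mem_biUnion.1 (hS ▸ Finset.mem_univ e : e ∈ covered x S)
  have hex : ∀ t : Fin k, ∃ a : TreeNode d k, a.IsAncestor w ∧ a.1.length = t := fun t =>
    w.exists_isAncestor_length (by omega)
  choose f hf hfl using hex
  -- The item `i` covering the missing element is none of the `k` path vertices, so it is the extra
  -- one.
  have hne : ∀ t, Sum.inl (f t) ≠ i := by
    rintro t rfl
    rcases (hf t).length_le.lt_or_eq with h | h
    · exact Finset.disjoint_left.1 (hw.disjoint (hf t) h) hi he
    · rw [(hf t).eq_of_length_le h.ge, hxw] at hi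
      simp at hi
  have hinj : Function.Injective fun t => (Sum.inl (f t) : TreeNode d k ⊕ U) := by
    intro t t' h
    have h' : f t = f t' := Sum.inl_injective h
    exact Fin.ext (by rw [← hfl t, ← hfl t', h'])
  have hsub : insert i (Finset.univ.image fun t => (Sum.inl (f t) : TreeNode d k ⊕ U)) ⊆ S := by
    refine Finset.insert_subset hiS (Finset.image_subset_iff.2 fun t _ => ?_)
    exact active_mem_cover hb hx hS hk (hw.of_isAncestor (hf t))
  have := Finset.card_le_card hsub
  rw [Finset.card_insert_of_notMem (by simpa using fun t => hne t),
    Finset.card_image_of_injective _ hinj, Finset.card_univ, Fintype.card_fin] at this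
  omega

end Cover

end Edifice

/-! ### The path-following algorithm and the optimum -/

/-- The elements not covered by the realizations seen so far. -/
def uncovered {ι U : Type} [Fintype U] [DecidableEq U] [Fintype ι]
    (ψ : PartialRealization ι U) : Finset U :=
  (Finset.univ.biUnion fun i => (ψ i).getD ∅)ᶜ

theorem uncovered_observe {ι U : Type} [Fintype U] [DecidableEq U] [Fintype ι] [DecidableEq ι]
    (x : ι → Finset U) (S : Finset ι) : uncovered (observe x S) = (covered x S)ᶜ := by
  rw [uncovered]
  congr 1
  ext e
  simp only [observe, covered, Finset.mem_biUnion, Finset.mem_univ, true_and]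
  refine exists_congr fun i => ?_
  by_cases hi : i ∈ S <;> simp [hi]

namespace Edifice

open TreeNode

variable {s b k d : ℕ} {U : Type} [Fintype U] [DecidableEq U] (T : Edifice s b k d U)

open Classical in
/-- The next item on the random path: its vertex is the one whose set is still to be covered. -/
noncomputable def descend (ψ : PartialRealization (TreeNode d k ⊕ U) U) : TreeNode d k ⊕ U :=
  if h : ∃ u, T.setAt u = uncovered ψ then Sum.inl h.choose
  else if h : ∃ e, uncovered ψ = {e} then Sum.inr h.choose
  -- A default that is never reached before the universe is covered.
  else Sum.inl ⟨[], T.one_le_k⟩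

variable {T}

theorem descend_of_eq_setAt (hs : s < b) {ψ : PartialRealization (TreeNode d k ⊕ U) U}
    {u : TreeNode d k} (h : uncovered ψ = T.setAt u) : T.descend ψ = Sum.inl u := by
  have hex : ∃ u, T.setAt u = uncovered ψ := ⟨u, h.symm⟩
  rw [descend, dif_pos hex]
  exact congrArg _ (T.setAt_injective hs (hex.choose_spec.trans h))

theorem descend_of_eq_singleton (hb : 1 < b) {ψ : PartialRealization (TreeNode d k ⊕ U) U}
    {e : U} (h : uncovered ψ = {e}) : T.descend ψ = Sum.inr e := by
  have hnex : ¬ ∃ u, T.setAt u = uncovered ψ := by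
    rintro ⟨u, hu⟩
    have := T.le_card_setAt u
    rw [hu, h, Finset.card_singleton] at this
    omega
  have hex : ∃ e, uncovered ψ = {e} := ⟨e, h⟩
  rw [descend, dif_neg hnex, dif_pos hex]
  exact congrArg _ (Finset.singleton_injective (hex.choose_spec.symm.trans h))

section

variable {x : TreeNode d k ⊕ U → Finset U}

theorem compl_covered_descend (hb : k * s < b) (hx : T.hardInstance.IsRealization x) {t : ℕ}
    (ht : t < k) : ∃ u : TreeNode d k, u.1.length = t ∧
      (covered x (adaptiveChosen T.descend x t))ᶜ = T.setAt u := by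
  have hs : s < b := (Nat.le_mul_of_pos_left s T.one_le_k).trans_lt hb
  induction t with
  | zero => exact ⟨⟨[], T.one_le_k⟩, rfl, by simp [adaptiveChosen, covered, T.setAt_root]⟩
  | succ t ih =>
    obtain ⟨u, rfl, hu⟩ := ih (by omega)
    obtain ⟨j, hj⟩ := realization_inner hx ht
    refine ⟨u.child ht j, length_child _ _ _, ?_⟩
    have hne : covered x (adaptiveChosen T.descend x u.1.length) ≠ Finset.univ := by
      intro h
      rw [h, Finset.compl_univ] at hu
      exact (T.setAt_nonempty u).ne_empty hu.symm
    rw [adaptiveChosen, if_neg hne,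
      descend_of_eq_setAt hs (by rw [uncovered_observe, hu]), covered_insert,
      Finset.compl_union, hu, hj, Finset.inter_comm, ← Finset.sdiff_eq_inter_compl,
      Finset.sdiff_sdiff_eq_self (T.setAt_child_subset u ht j)]

theorem covered_descend (hb : k * s < b) (hx : T.hardInstance.IsRealization x) :
    covered x (adaptiveChosen T.descend x (k + 1)) = Finset.univ := by
  have hs : s < b := (Nat.le_mul_of_pos_left s T.one_le_k).trans_lt hb
  have hk := T.one_le_k
  obtain ⟨u, hlen, hu⟩ := compl_covered_descend hb hx (t := k - 1) (by omega)
  obtain ⟨e, he, hxu⟩ := realization_leaf hx (u := u) (by omega)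
  have hne : covered x (adaptiveChosen T.descend x (k - 1)) ≠ Finset.univ := by
    intro h
    rw [h, Finset.compl_univ] at hu
    exact (T.setAt_nonempty u).ne_empty hu.symm
  have h1 : (covered x (adaptiveChosen T.descend x k))ᶜ = {e} := by
    obtain ⟨k', hk'⟩ : ∃ k', k = k' + 1 := ⟨k - 1, by omega⟩
    have hk'' : k - 1 = k' := by omega
    rw [hk''] at hu hne
    have : adaptiveChosen T.descend x k = adaptiveChosen T.descend x (k' + 1) := congrArg _ hk'
    rw [this, adaptiveChosen, if_neg hne,
      descend_of_eq_setAt hs (by rw [uncovered_observe, hu]), covered_insert,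
      Finset.compl_union, hu, hxu, Finset.inter_comm, ← Finset.sdiff_eq_inter_compl,
      Finset.sdiff_sdiff_eq_self (Finset.singleton_subset_iff.2 he)]
  have hne' : covered x (adaptiveChosen T.descend x k) ≠ Finset.univ := by
    intro h
    rw [h, Finset.compl_univ] at h1
    exact Finset.singleton_ne_empty e h1.symm
  have h1b : 1 < b := T.one_le_s.trans_lt hs
  rw [adaptiveChosen, if_neg hne',
    descend_of_eq_singleton h1b (by rw [uncovered_observe, h1]), covered_insert,
    realization_elem hx, ← h1, Finset.union_comm, Finset.union_compl]

theorem card_adaptiveChosen_descend (hb : k * s < b) (hx : T.hardInstance.IsRealization x) :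
    (adaptiveChosen T.descend x (k + 1)).card = k + 1 :=
  le_antisymm (card_adaptiveChosen_le _ _ _) (card_cover hb hx (covered_descend hb hx))

theorem sequentialStrategy_descend (hb : k * s < b) (hx : T.hardInstance.IsRealization x) :
    (sequentialStrategy T.descend).chosen x (k + 1) = adaptiveChosen T.descend x (k + 1) :=
  sequentialStrategy_chosen (card_adaptiveChosen_descend hb hx).ge

theorem adaptiveChosen_descend_card (hb : k * s < b) (hx : T.hardInstance.IsRealization x) :
    adaptiveChosen T.descend x (Fintype.card (TreeNode d k ⊕ U)) =
      adaptiveChosen T.descend x (k + 1) :=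
  adaptiveChosen_of_covered (covered_descend hb hx)
    ((card_adaptiveChosen_descend hb hx).symm.trans_le (Finset.card_le_univ _))

end

variable (T)

/-- Following the random path to the missing element, one item per round. -/
noncomputable def pathAlgorithm (hb : k * s < b) : RoundAlgorithm T.hardInstance (k + 1) where
  toRoundStrategy := sequentialStrategy T.descend
  covers x hx := by rw [sequentialStrategy_descend hb hx, covered_descend hb hx]

noncomputable def adaptivePathAlgorithm (hb : k * s < b) : AdaptiveAlgorithm T.hardInstance where
  next := T.descend
  covers x hx := by rw [adaptiveChosen_descend_card hb hx, covered_descend hb hx]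

theorem cost_pathAlgorithm (hb : k * s < b) {x : TreeNode d k ⊕ U → Finset U}
    (hx : T.hardInstance.IsRealization x) : (T.pathAlgorithm hb).cost x = k + 1 := by
  rw [RoundAlgorithm.cost, pathAlgorithm, sequentialStrategy_descend hb hx,
    card_adaptiveChosen_descend hb hx]

theorem expectedCost_pathAlgorithm (hb : k * s < b) :
    (T.pathAlgorithm hb).expectedCost = ((k + 1 : ℕ) : ℝ≥0∞) := by
  rw [RoundAlgorithm.expectedCost, ← T.hardInstance.expect_const ((k + 1 : ℕ) : ℝ≥0∞)]
  exact le_antisymm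
    (T.hardInstance.expect_mono fun x hx => by rw [cost_pathAlgorithm T hb hx])
    (T.hardInstance.expect_mono fun x hx => by rw [cost_pathAlgorithm T hb hx])

theorem optCost_hardInstance (hb : k * s < b) :
    T.hardInstance.optCost = ((k + 1 : ℕ) : ℝ≥0∞) := by
  refine le_antisymm ((iInf_le _ (T.adaptivePathAlgorithm hb)).trans ?_) (le_iInf fun A => ?_)
  · conv_rhs => rw [← T.hardInstance.expect_const ((k + 1 : ℕ) : ℝ≥0∞)]
    refine T.hardInstance.expect_mono fun x hx => ?_
    rw [adaptivePathAlgorithm, adaptiveChosen_descend_card hb hx,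
      card_adaptiveChosen_descend hb hx]
  · conv_lhs => rw [← T.hardInstance.expect_const ((k + 1 : ℕ) : ℝ≥0∞)]
    exact T.hardInstance.expect_mono fun x hx => Nat.cast_le.2 (card_cover hb hx (A.covers x hx))

end Edifice

/-! ### Probability of luck and the lower bound -/

/-- The items whose realizations have been seen. -/
def seen {ι U : Type} [Fintype ι] (ψ : PartialRealization ι U) : Finset ι :=
  Finset.univ.filter fun i => (ψ i).isSome

theorem seen_observe {ι U : Type} [Fintype ι] [DecidableEq ι] (x : ι → Finset U) (S : Finset ι) :
    seen (observe x S) = S := by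
  ext i
  by_cases hi : i ∈ S <;> simp [seen, observe, hi]

namespace Edifice

open TreeNode

variable {s b k d : ℕ} {U : Type} [Fintype U] [DecidableEq U] (T : Edifice s b k d U)

section Law

theorem sum_law_inner (hs : s < b) {u : TreeNode d k} (h : u.1.length + 1 < k)
    (J : Finset (Fin d)) :
    ∑ Y, T.hardInstance.law (Sum.inl u) Y *
      (if Y ∈ J.image fun j => T.setAt u \ T.setAt (u.child h j) then 1 else 0) =
      J.card / d := by
  have hne := T.nonempty_children
  simp only [hardInstance, hardLaw, dif_pos h]
  rw [PMF.sum_map_mul]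
  have hmem : ∀ j, (T.setAt u \ T.setAt (u.child h j) ∈
      J.image fun j => T.setAt u \ T.setAt (u.child h j)) ↔ j ∈ J := fun j =>
    Finset.mem_image.trans ⟨fun ⟨i, hi, hij⟩ => child_eq_of_sdiff_eq (T := T) hs hij ▸ hi,
      fun hj => ⟨j, hj, rfl⟩⟩
  simp only [hmem, PMF.uniformOfFintype_apply, Fintype.card_fin, mul_ite, mul_one, mul_zero,
    Finset.sum_ite_mem, Finset.univ_inter, Finset.sum_const, nsmul_eq_mul]
  rw [ENNReal.div_eq_inv_mul, mul_comm]

theorem sum_law_leaf {u : TreeNode d k} (h : ¬ u.1.length + 1 < k) {H : Finset U}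
    (hH : H ⊆ T.setAt u) :
    ∑ Y, T.hardInstance.law (Sum.inl u) Y *
      (if Y ∈ H.image fun e => T.setAt u \ {e} then 1 else 0) = H.card / b := by
  simp only [hardInstance, hardLaw, dif_neg h]
  rw [PMF.sum_map_mul]
  have hleaf : (T.setAt u).card = b :=
    T.card_setAt_leaf u (by have := u.2; unfold IsLeaf; omega)
  have hmem : ∀ e ∈ T.setAt u,
      ((T.setAt u \ {e} ∈ H.image fun e => T.setAt u \ {e}) ↔ e ∈ H) := by
    intro e he
    refine Finset.mem_image.trans ⟨?_, fun he => ⟨e, he, rfl⟩⟩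
    rintro ⟨e', he', hee⟩
    have h1 : e ∉ T.setAt u \ {e'} := by rw [hee]; simp
    have h2 : e = e' := by simpa [he] using h1
    rwa [h2]
  have hterm : ∀ e, PMF.uniformOfFinset (T.setAt u) (T.setAt_leaf_nonempty u h) e *
      (if T.setAt u \ {e} ∈ H.image fun e => T.setAt u \ {e} then 1 else 0) =
      if e ∈ H then (b : ℝ≥0∞)⁻¹ else 0 := by
    intro e
    by_cases he : e ∈ T.setAt u
    · simp only [hmem e he, PMF.uniformOfFinset_apply, he, if_true, hleaf, mul_ite, mul_one,
        mul_zero]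
    · have : e ∉ H := fun h => he (hH h)
      simp [PMF.uniformOfFinset_apply, he, this]
  simp only [hterm, Finset.sum_ite_mem, Finset.univ_inter, Finset.sum_const, nsmul_eq_mul]
  rfl

end Law

/-! ### The lower bound for `k` rounds -/

section LowerBound

variable {T} (A : RoundAlgorithm T.hardInstance k) (M : ℕ)

open Classical in
/-- The children of `u` with a descendant among the first `M` items that the algorithm is about to
insert. -/
noncomputable def hitChildren (ψ : PartialRealization (TreeNode d k ⊕ U) U) (u : TreeNode d k)
    (h : u.1.length + 1 < k) : Finset (Fin d) :=
  Finset.univ.filter fun j => ∃ v : TreeNode d k, (u.child h j).IsAncestor v ∧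
    Sum.inl v ∈ (A.order u.1.length ψ).take M

open Classical in
/-- The items that have been seen or are among the first `M` that the algorithm is about to insert,
other than those of the ancestors of `u`. -/
noncomputable def hitItems (ψ : PartialRealization (TreeNode d k ⊕ U) U) (u : TreeNode d k) :
    Finset (TreeNode d k ⊕ U) :=
  (seen ψ ∪ ((A.order u.1.length ψ).take M).toFinset).filter
    fun i => ∀ v, i = Sum.inl v → ¬ v.IsAncestor u

open Classical in
/-- The values of the stochastic set of `u` by which the algorithm, having seen `ψ`, hits the
random path, or the missing element if `u` is a leaf. -/
noncomputable def luckySets (ψ : PartialRealization (TreeNode d k ⊕ U) U) (u : TreeNode d k) :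
    Finset (Finset U) :=
  if h : u.1.length + 1 < k then
    (hitChildren A M ψ u h).image fun j => T.setAt u \ T.setAt (u.child h j)
  -- The guard makes the probability bound hold for every `ψ`; runs of cost at most `M` satisfy it.
  else if (seen ψ).card ≤ M then
    ((hitItems A M ψ u).biUnion fun i => T.setAt u ∩ T.base i).image fun e => T.setAt u \ {e}
  else ∅

/-- At the vertex `u` of the random path, whose item has not been seen when round `|u|` starts, the
algorithm hits the continuation of the path in that round. -/
def Lucky (x : TreeNode d k ⊕ U → Finset U) (u : TreeNode d k) : Prop :=
  T.Active x u ∧ Sum.inl u ∉ A.chosen x u.1.length ∧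
    x (Sum.inl u) ∈ luckySets A M (observe x (A.chosen x u.1.length)) u

theorem card_hitChildren_le (ψ : PartialRealization (TreeNode d k ⊕ U) U) (u : TreeNode d k)
    (h : u.1.length + 1 < k) : (hitChildren A M ψ u h).card ≤ M := by
  classical
  have : Nonempty (TreeNode d k) := ⟨u⟩
  have hex : ∀ j ∈ hitChildren A M ψ u h, ∃ v : TreeNode d k, (u.child h j).IsAncestor v ∧
      Sum.inl v ∈ (A.order u.1.length ψ).take M := fun j hj => (Finset.mem_filter.1 hj).2
  choose! f hf hfM using hex
  calc (hitChildren A M ψ u h).card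
      ≤ ((A.order u.1.length ψ).take M).toFinset.card :=
        Finset.card_le_card_of_injOn (fun j => Sum.inl (f j))
          (fun j hj => List.mem_toFinset.2 (hfM j hj)) fun i hi j hj hij => by
            have hij' : f i = f j := Sum.inl_injective hij
            exact child_isAncestor_inj (hf i hi) (hij' ▸ hf j hj)
    _ ≤ ((A.order u.1.length ψ).take M).length := List.toFinset_card_le _
    _ ≤ M := List.length_take_le _ _

theorem card_biUnion_hitItems_le {ψ : PartialRealization (TreeNode d k ⊕ U) U} {u : TreeNode d k}
    (hu : u.IsLeaf) (hψ : (seen ψ).card ≤ M) :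
    ((hitItems A M ψ u).biUnion fun i => T.setAt u ∩ T.base i).card ≤ 2 * M * s := by
  classical
  refine (Finset.card_biUnion_le_card_mul _ _ s fun i hi =>
    T.card_inter_base_le hu (Finset.mem_filter.1 hi).2).trans (Nat.mul_le_mul_right s ?_)
  refine (Finset.card_filter_le _ _).trans ((Finset.card_union_le _ _).trans ?_)
  have h1 := List.toFinset_card_le ((A.order u.1.length ψ).take M)
  have h2 := List.length_take_le M (A.order u.1.length ψ)
  omega

/-- A bound for the probability of being lucky at a vertex of depth `t`. -/
noncomputable def luckBound (s b k d M t : ℕ) : ℝ≥0∞ :=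
  if t + 1 < k then (M : ℝ≥0∞) / d else ((2 * M * s : ℕ) : ℝ≥0∞) / b

theorem sum_law_luckySets_le (hs : s < b) (ψ : PartialRealization (TreeNode d k ⊕ U) U)
    (u : TreeNode d k) :
    ∑ Y, T.hardInstance.law (Sum.inl u) Y * (if Y ∈ luckySets A M ψ u then 1 else 0) ≤
      luckBound s b k d M u.1.length := by
  unfold luckySets luckBound
  by_cases h : u.1.length + 1 < k
  · simp only [dif_pos h, if_pos h]
    rw [T.sum_law_inner hs h]
    exact ENNReal.div_le_div_right (Nat.cast_le.2 (card_hitChildren_le A M ψ u h)) _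
  · simp only [dif_neg h, if_neg h]
    split_ifs with hψ
    · rw [T.sum_law_leaf h (Finset.biUnion_subset.2 fun i _ => Finset.inter_subset_left)]
      refine ENNReal.div_le_div_right (Nat.cast_le.2 (card_biUnion_hitItems_le A M ?_ hψ)) _
      have := u.2
      unfold IsLeaf
      omega
    · simp

-- Being active depends only on items of smaller depth. With all items but `u` frozen, the view
-- before round `|u|` is the same for all values of `u` that leave it unchosen, so the lucky values
-- lie in one fixed family.
open Classical in
theorem expect_lucky_le (hs : s < b) (u : TreeNode d k) :
    (T.hardInstance.expect fun x => if Lucky A M x u then 1 else 0) ≤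
      luckBound s b k d M u.1.length *
        T.hardInstance.expect fun x => if T.Active x u then 1 else 0 := by
  refine T.hardInstance.expect_indicator_le (Sum.inl u) _ _ _ ?_ ?_
  · intro x Y h
    refine h.1.congr fun a ha => Function.update_of_ne ?_ _ _
    rintro hau
    rw [Sum.inl_injective hau] at ha
    exact lt_irrefl _ ha
  · intro x
    by_cases hex : ∃ Y, Lucky A M (Function.update x (Sum.inl u) Y) u
    -- Any one lucky value `Y₀` determines that common view.
    · obtain ⟨Y₀, hY₀⟩ := hex
      refine le_trans (Finset.sum_le_sum fun Y _ => mul_le_mul_right ?_ _)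
        (sum_law_luckySets_le A M hs (observe (Function.update x (Sum.inl u) Y₀)
          (A.chosen (Function.update x (Sum.inl u) Y₀) u.1.length)) u)
      by_cases hY : Lucky A M (Function.update x (Sum.inl u) Y) u
      · have hmem := hY.2.2
        have hup : Function.update x (Sum.inl u) Y =
            Function.update (Function.update x (Sum.inl u) Y₀) (Sum.inl u) Y := by simp
        rw [Function.update_self, hup, A.observe_update hY₀.2.1] at hmem
        rw [if_pos hY, if_pos hmem]
      · simp [hY]
    · push Not at hex
      simp [hex]

-- The random path has at most one vertex of each depth, so the sum over the tree reduces to one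
-- over depths.
open Classical in
theorem sum_luckBound_active_le (hs : s < b) (x : TreeNode d k ⊕ U → Finset U) :
    ∑ u, luckBound s b k d M u.1.length * (if T.Active x u then 1 else 0) ≤
      k * ((M : ℝ≥0∞) / d) + ((2 * M * s : ℕ) : ℝ≥0∞) / b := by
  simp only [mul_ite, mul_one, mul_zero]
  rw [← Finset.sum_filter]
  have hinj : Set.InjOn (fun u : TreeNode d k => u.1.length)
      (Finset.univ.filter fun u => T.Active x u) := fun u hu v hv huv =>
    (Finset.mem_filter.1 hu).2.eq hs (Finset.mem_filter.1 hv).2 huv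
  rw [← Finset.sum_image (f := fun t => luckBound s b k d M t) hinj]
  have hsub : ((Finset.univ.filter fun u => T.Active x u).image fun u => u.1.length) ⊆
      Finset.range k := Finset.image_subset_iff.2 fun u _ => Finset.mem_range.2 u.2
  refine (Finset.sum_le_sum_of_subset hsub).trans ?_
  obtain ⟨k', hk⟩ : ∃ k', k = k' + 1 := ⟨k - 1, by have := T.one_le_k; omega⟩
  rw [hk, Finset.sum_range_succ]
  refine add_le_add ?_ (by simp [luckBound])
  calc ∑ t ∈ Finset.range k', luckBound s b (k' + 1) d M t
      ≤ ∑ t ∈ Finset.range k', (M : ℝ≥0∞) / d := Finset.sum_le_sum fun t ht => by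
        rw [luckBound, if_pos (by have := Finset.mem_range.1 ht; omega)]
    _ = k' * ((M : ℝ≥0∞) / d) := by simp
    _ ≤ ((k' + 1 : ℕ) : ℝ≥0∞) * ((M : ℝ≥0∞) / d) :=
        mul_le_mul_left (Nat.cast_le.2 (Nat.le_succ _)) _

/-- A cheap algorithm that is never lucky has inserted no vertex of the random path of depth `t` or
more after `t` rounds. -/
theorem notMem_chosen_of_not_lucky {x : TreeNode d k ⊕ U → Finset U} (hcost : A.cost x ≤ M)
    (hl : ∀ u, ¬ Lucky A M x u) {t : ℕ} (ht : t < k) {w : TreeNode d k} (hw : T.Active x w)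
    (htw : t ≤ w.1.length) : Sum.inl w ∉ A.chosen x t := by
  classical
  induction t generalizing w with
  | zero => simp [RoundStrategy.chosen]
  | succ t ih =>
    intro hmem
    have hcard : (A.chosen x (t + 1)).card ≤ M :=
      (Finset.card_le_card (A.chosen_mono x ht.le)).trans hcost
    have htake := (A.mem_chosen_succ hcard hmem).resolve_left (ih (by omega) hw (by omega))
    -- The depth-`t` ancestor `u` of `w` is itself unchosen before round `t`, yet `w` lies below its
    -- realized child and among the first `M` items: luck at `u`.
    obtain ⟨u, huw, rfl⟩ := w.exists_isAncestor_length (t := t) (by omega)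
    obtain ⟨h, j, hj⟩ := exists_child_isAncestor huw (by omega)
    have hu : T.Active x u := hw.of_isAncestor huw
    refine hl u ⟨hu, ih (by omega) hu le_rfl, ?_⟩
    rw [luckySets, dif_pos h, hw u h j hj]
    exact Finset.mem_image_of_mem _ (Finset.mem_filter.2 ⟨Finset.mem_univ _, w, hj, htake⟩)

/-- Without luck earlier, the path's leaf is unseen when the last round starts. The missing element
is covered by an item off the path that was seen or is among the next `M`, which is luck at the
leaf. -/
theorem exists_lucky {x : TreeNode d k ⊕ U → Finset U} (hx : T.hardInstance.IsRealization x)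
    (hcost : A.cost x ≤ M) : ∃ u, Lucky A M x u := by
  classical
  by_contra! hl
  have hk1 := T.one_le_k
  obtain ⟨w, hw, hlen⟩ := exists_active hx (t := k - 1) (by omega)
  have hnl : ¬ w.1.length + 1 < k := by omega
  obtain ⟨e, he, hxw⟩ := realization_leaf hx hnl
  have hwS := notMem_chosen_of_not_lucky A M hcost hl w.2 hw le_rfl
  have hk : A.chosen x k = A.chosen x (w.1.length + 1) := congrArg _ (by omega)
  have hcard : (A.chosen x (w.1.length + 1)).card ≤ M := hk ▸ hcost
  obtain ⟨i, hiS, hi⟩ :=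
    Finset.mem_biUnion.1 (A.covers x hx ▸ Finset.mem_univ e : e ∈ covered x (A.chosen x k))
  rw [hk] at hiS
  have hanc : ∀ v, i = Sum.inl v → ¬ v.IsAncestor w := by
    rintro v rfl hv
    rcases hv.length_le.lt_or_eq with h | h
    · exact Finset.disjoint_left.1 (hw.disjoint hv h) hi he
    · rw [hv.eq_of_length_le h.ge, hxw] at hi
      simp at hi
  refine hl w ⟨hw, hwS, ?_⟩
  rw [luckySets, dif_neg hnl, seen_observe, if_pos
    ((Finset.card_le_card (A.chosen_subset_succ x _)).trans hcard), hxw]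
  refine Finset.mem_image_of_mem _ (Finset.mem_biUnion.2 ⟨i, ?_,
    Finset.mem_inter.2 ⟨he, realization_subset_base hx i hi⟩⟩)
  refine Finset.mem_filter.2 ⟨?_, hanc⟩
  rw [seen_observe, Finset.mem_union, List.mem_toFinset]
  exact A.mem_chosen_succ hcard hiS

/-- Pointwise, either the cost exceeds `M` or some vertex is lucky, so `M` is at most the cost plus
`M` times the number of lucky vertices. -/
theorem le_expectedCost (hs : s < b) :
    (M : ℝ≥0∞) ≤ A.expectedCost +
      M * (k * ((M : ℝ≥0∞) / d) + ((2 * M * s : ℕ) : ℝ≥0∞) / b) := by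
  classical
  calc (M : ℝ≥0∞) = T.hardInstance.expect fun _ => (M : ℝ≥0∞) := (T.hardInstance.expect_const _).symm
    _ ≤ T.hardInstance.expect fun x => (A.cost x : ℝ≥0∞) +
          M * ∑ u, if Lucky A M x u then 1 else 0 := by
        refine T.hardInstance.expect_mono fun x hx => ?_
        rcases le_or_gt (A.cost x) M with h | h
        · obtain ⟨u, hu⟩ := exists_lucky A M hx h
          refine le_add_left ?_
          conv_lhs => rw [← mul_one (M : ℝ≥0∞)]
          refine mul_le_mul_right ?_ _
          refine le_trans ?_ (Finset.single_le_sum (fun _ _ => zero_le) (Finset.mem_univ u))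
          rw [if_pos hu]
        · exact le_add_right (Nat.cast_le.2 h.le)
    _ = A.expectedCost +
          M * ∑ u, T.hardInstance.expect fun x => if Lucky A M x u then 1 else 0 := by
        rw [T.hardInstance.expect_add, T.hardInstance.expect_const_mul, T.hardInstance.expect_sum]
        rfl
    _ ≤ A.expectedCost + M * T.hardInstance.expect fun x =>
          ∑ u, luckBound s b k d M u.1.length * (if T.Active x u then 1 else 0) := by
        rw [T.hardInstance.expect_sum]
        simp only [T.hardInstance.expect_const_mul]
        exact add_le_add le_rfl
          (mul_le_mul_right (Finset.sum_le_sum fun u _ => expect_lucky_le A M hs u) _)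
    _ ≤ _ := by
        refine add_le_add le_rfl (mul_le_mul_right ?_ _)
        conv_rhs => rw [← T.hardInstance.expect_const (_ + _)]
        exact T.hardInstance.expect_mono fun x _ => sum_luckBound_active_le M hs x

end LowerBound

end Edifice

/-! ### Randomization and constants -/

theorem RandomizedRoundAlgorithm.le_expectedCost {ι U : Type} [Fintype ι] [DecidableEq ι]
    [Fintype U] [DecidableEq U] {I : StochasticSetCover ι U} {r : ℕ}
    (A : RandomizedRoundAlgorithm I r) {c : ℝ≥0∞} (h : ∀ D : RoundAlgorithm I r, c ≤ D.expectedCost) :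
    c ≤ A.expectedCost := by
  calc c = ∑' D : RoundAlgorithm I r, A D * c := by
        rw [ENNReal.tsum_mul_right, A.tsum_coe, one_mul]
    _ ≤ A.expectedCost := ENNReal.tsum_le_tsum fun D => mul_le_mul_right (h D) _

namespace Edifice

variable {r N : ℕ} {U : Type} [Fintype U]

theorem card_items_le (hr : 1 ≤ r) (hN : 2 ≤ N) (hU : Fintype.card U = N ^ r) :
    Fintype.card (TreeNode (N ^ 2) r ⊕ U) ≤ Fintype.card U ^ (4 * r) := by
  rw [Fintype.card_sum, hU]
  have h1 : Fintype.card (TreeNode (N ^ 2) r) ≤ N ^ (3 * r) := by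
    refine (TreeNode.card_le _ _).trans ?_
    rw [pow_mul]
    exact Nat.pow_le_pow_left (by nlinarith [Nat.one_le_two_pow (n := 2)]) r
  calc Fintype.card (TreeNode (N ^ 2) r) + N ^ r ≤ N ^ (3 * r) + N ^ (3 * r) :=
        add_le_add h1 (Nat.pow_le_pow_right (by omega) (by omega))
    _ = 2 * N ^ (3 * r) := (two_mul _).symm
    _ ≤ N * N ^ (3 * r) := Nat.mul_le_mul_right _ hN
    _ = N ^ (3 * r + 1) := (pow_succ' _ _).symm
    _ ≤ N ^ (r * (4 * r)) := Nat.pow_le_pow_right (by omega) (by nlinarith)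
    _ = (N ^ r) ^ (4 * r) := pow_mul _ _ _

variable [DecidableEq U]

theorem div_le_expectedCost (hr : 1 ≤ r) (hN : 16 * r ^ 2 ≤ N)
    {T : Edifice (4 * r) N r (N ^ 2) U} (D : RoundAlgorithm T.hardInstance r) :
    ENNReal.ofReal ((N : ℝ) / (128 * r)) ≤ D.expectedCost := by
  rcases eq_or_ne D.expectedCost ⊤ with htop | htop
  · simp [htop]
  -- This makes the leaf term `8 * M * r / N` at most `1 / 2` and the other at most `1 / 4`. The
  -- cost is then at least `M / 4`, and `M ≥ N / (32 * r)` gives the constant `128`.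
  set M := N / (16 * r) with hM
  have hr2 : r ≤ r ^ 2 := Nat.le_self_pow two_ne_zero r
  have h := le_expectedCost D M (by nlinarith : 4 * r < N)
  have hN0 : (N : ℝ≥0∞) ≠ 0 := Nat.cast_ne_zero.2 (by omega)
  have hd0 : ((N ^ 2 : ℕ) : ℝ≥0∞) ≠ 0 := Nat.cast_ne_zero.2 (pow_ne_zero _ (by omega))
  have h1 : (r : ℝ≥0∞) * ((M : ℝ≥0∞) / (N ^ 2 : ℕ)) ≠ ⊤ :=
    ENNReal.mul_ne_top (ENNReal.natCast_ne_top _) (ENNReal.div_ne_top (ENNReal.natCast_ne_top _) hd0)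
  have h2 : ((2 * M * (4 * r) : ℕ) : ℝ≥0∞) / N ≠ ⊤ :=
    ENNReal.div_ne_top (ENNReal.natCast_ne_top _) hN0
  have h3 := ENNReal.mul_ne_top (ENNReal.natCast_ne_top M) (ENNReal.add_ne_top.2 ⟨h1, h2⟩)
  have h' := ENNReal.toReal_mono (ENNReal.add_ne_top.2 ⟨htop, h3⟩) h
  rw [ENNReal.toReal_add htop h3, ENNReal.toReal_mul, ENNReal.toReal_add h1 h2] at h'
  simp only [ENNReal.toReal_mul, ENNReal.toReal_div, ENNReal.toReal_natCast] at h'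
  rw [← ENNReal.ofReal_toReal htop]
  refine ENNReal.ofReal_le_ofReal ?_
  have hMle : M * (16 * r) ≤ N := Nat.div_mul_le_self _ _
  have hM1 : 1 ≤ M := (Nat.one_le_div_iff (by omega)).2 (by omega)
  have hMlt : N < 16 * r * (M + 1) := Nat.lt_mul_div_succ N (by omega)
  have hMgt : N ≤ 32 * r * M := by nlinarith
  have hrR : (1 : ℝ) ≤ r := by exact_mod_cast hr
  have hMR : (1 : ℝ) ≤ M := by exact_mod_cast hM1
  have hNR : (16 : ℝ) ≤ N := by exact_mod_cast (by omega : 16 ≤ N)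
  have hMleR : (M : ℝ) * (16 * r) ≤ N := by exact_mod_cast hMle
  have hMgtR : (N : ℝ) ≤ 32 * r * M := by exact_mod_cast hMgt
  have hb1 : (r : ℝ) * (M / ((N ^ 2 : ℕ) : ℝ)) ≤ 1 / 4 := by
    push_cast
    rw [← mul_div_assoc, div_le_iff₀ (by positivity)]
    nlinarith
  have hb2 : ((2 * M * (4 * r) : ℕ) : ℝ) / N ≤ 1 / 2 := by
    push_cast
    rw [div_le_iff₀ (by positivity)]
    linarith
  have hb3 : (M : ℝ) * (r * (M / ((N ^ 2 : ℕ) : ℝ)) + ((2 * M * (4 * r) : ℕ) : ℝ) / N) ≤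
      M * (3 / 4) := mul_le_mul_of_nonneg_left (by linarith) (by linarith)
  rw [div_le_iff₀ (by positivity)]
  nlinarith

theorem lowerBound (hr : 1 ≤ r) (hN : 16 * r ^ 2 ≤ N) (hU : Fintype.card U = N ^ r)
    (T : Edifice (4 * r) N r (N ^ 2) U) (A : RandomizedRoundAlgorithm T.hardInstance r) :
    ENNReal.ofReal (1 / 256 * ((Fintype.card U : ℝ) ^ ((1 : ℝ) / (r : ℝ)) / (r : ℝ) ^ 3)) *
      T.hardInstance.optCost ≤ A.expectedCost := by
  refine A.le_expectedCost fun D => le_trans ?_ (div_le_expectedCost hr hN D)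
  have hrR : (1 : ℝ) ≤ r := by exact_mod_cast hr
  rw [T.optCost_hardInstance (by nlinarith), hU, Nat.cast_pow, one_div (r : ℝ),
    Real.pow_rpow_inv_natCast (Nat.cast_nonneg _) (by omega), ← ENNReal.ofReal_natCast,
    ← ENNReal.ofReal_mul (by positivity)]
  refine ENNReal.ofReal_le_ofReal ?_
  -- The optimum `r + 1` is absorbed by two of the three powers of `r`.
  have h : ((r + 1 : ℕ) : ℝ) ≤ 2 * r ^ 2 := by
    push_cast
    nlinarith
  calc 1 / 256 * ((N : ℝ) / r ^ 3) * ((r + 1 : ℕ) : ℝ)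
      ≤ 1 / 256 * ((N : ℝ) / r ^ 3) * (2 * r ^ 2) := by gcongr
    _ = (N : ℝ) / (128 * r) := by
      field_simp
      ring

end Edifice

theorem mainTheorem2 :
    {N : ℕ | ∀ r : ℕ, 1 ≤ r → 4 * r ≤ N →
      Nonempty (Edifice (4 * r) N r (N ^ 2) (Fin (N ^ r)))}.Infinite ∧
    ∃ c : ℝ, 0 < c ∧ ∃ C K : ℕ,
      ∀ r N : ℕ, 1 ≤ r → K * r ^ 2 ≤ N →
      ∀ (U : Type) [Fintype U] [DecidableEq U], Fintype.card U = N ^ r →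
      ∀ T : Edifice (4 * r) N r (N ^ 2) U,
        Fintype.card (TreeNode (N ^ 2) r ⊕ U) ≤ Fintype.card U ^ (C * r) ∧
        (∀ A : RandomizedRoundAlgorithm T.hardInstance r,
          ENNReal.ofReal (c * ((Fintype.card U : ℝ) ^ ((1 : ℝ) / (r : ℝ)) / (r : ℝ) ^ 3)) *
            T.hardInstance.optCost ≤ A.expectedCost) ∧
        ∃ B : RoundAlgorithm T.hardInstance (r + 1),
          (∀ x, T.hardInstance.IsRealization x → B.cost x ≤ r + 1) ∧
          B.expectedCost = T.hardInstance.optCost := by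
  refine ⟨infinite_setOf_edifice, 1 / 256, by norm_num, 4, 16, ?_⟩
  intro r N hr hN U _ _ hU T
  -- This is `k * s < b`, the condition under which the optimum is `r + 1`.
  have hb : r * (4 * r) < N := by nlinarith
  refine ⟨Edifice.card_items_le hr (by nlinarith) hU, T.lowerBound hr hN hU,
    T.pathAlgorithm hb, fun x hx => (T.cost_pathAlgorithm hb hx).le, ?_⟩
  rw [T.expectedCost_pathAlgorithm hb, T.optCost_hardInstance hb]
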